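/- Let $0\le s<r,q<p\le 1$, let $B=\begin{pmatrix}p&q\\ r&s\end{pmatrix}$ have rank $2$ (block $1$ is the core, block $2$ the periphery), and let $\pi=(\pi_1,\pi_2)\in(0,1)^2$ with $\pi_1+\pi_2=1$. For each $N\ge 1$ let $\tau=\tau^{(N)}:[N]\to\{1,2\}$ be a random block membership function and let $A=A^{(N)}\in\{0,1\}^{N\times N}$ be the adjacency matrix of a directed stochastic block model: given $\tau$, $A_{ii}=0$ and the entries $A_{ij}$, $i\ne j$, are independent Bernoulli variables with means $B_{\tau(i)\tau(j)}$. The matrices for all $N$ live on one probability space, with arbitrary dependence between different $N$. The block memberships are either i.i.d. with distribution $\pi$ for each $N$, or have proportions $n_i/N\to\pi_i$ almost surely, where $G_i=\{u:\tau(u)=i\}$ and $n_i=|G_i|$. Let $b$ be the second (smallest) singular value of $B$, and let $\beta>0$ be such that for some factorization $B=\nu\mu^\top$ with $\nu,\mu\in\mathbb R^{2\times 2}$, whose rows are $\nu_i,\mu_i$, one has $\beta<\|\nu_1-\nu_2\|$ or $\beta<\|\mu_1-\mu_2\|$. Let $U,V\in\mathbb R^{N\times 2}$ be the left and right singular vectors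 of the two largest singular values in a singular value decomposition of $A$, put $W=[U|V]\in\mathbb R^{N\times 4}$ with rows $W_u$, and let $(\hat c,\hat\tau)$, with $\hat c_1,\hat c_2\in\mathbb R^4$ and $\hat\tau:[N]\to\{1,2\}$, minimize $\sum_{u=1}^N\|W_u-\hat c_{\hat\tau(u)}\|^2$. Then almost surely, for all but finitely many $N$, for every such choice of $U,V$ and every minimizer, $$\min_{\rho\in S_2}\bigl|\{u\in[N]:\tau(u)\ne\rho(\hat\tau(u))\}\bigr|\;\le\;\frac{2^2\,3^2\cdot 6\;T}{\beta^2\,(b\,\tilde\pi)^5}\,\log N,$$ where $\tilde\pi=\min_i n_i/N$, and $T>0$ is given by $$TN^2=\Bigl[\sum_{w\in G_1}(1-r^2)+\sum_{w\in G_2}(1-s^2)\Bigr]^2+\Bigl[\sum_{w\in G_1}(1-q^2)+\sum_{w\in G_2}(1-s^2)\Bigr]^2 .$$ The same holds with $n_i/N$ replaced by $\pi_i$ in $\tilde\pi$ and in $T$, that is, with the constants $\tilde\pi=\min(\pi_1,\pi_2)$ and $T=[\pi_1(1-r^2)+\pi_2(1-s^2)]^2+[\pi_1(1-q^2)+\pi_2(1-s^2)]^2>0$,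 which do not depend on $N$. -/

import Mathlib

open MeasureTheory Filter Topology Matrix

/-- The `N × N` adjacency matrix of a directed graph on `Fin N`, given by its edge indicators:
the entry `(i, j)` is `1` if there is an edge from `i` to `j`, and `0` otherwise. -/
def adjacencyMatrix {N : ℕ} (a : Fin N → Fin N → Bool) : Matrix (Fin N) (Fin N) ℝ :=
  Matrix.of fun i j => if a i j then 1 else 0

/-- The conditional probability of the directed graph `a` given the block memberships `t`: there
are no loops, and for `i ≠ j` the entries are independent Bernoulli with mean `B (t i) (t j)`. -/
def edgeProbability {N K : ℕ} (B : Matrix (Fin K) (Fin K) ℝ) (t : Fin N → Fin K)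
    (a : Fin N → Fin N → Bool) : ℝ :=
  ∏ i, ∏ j,
    if i = j then (if a i j then 0 else 1)
    else (if a i j then B (t i) (t j) else 1 - B (t i) (t j))

/-- For every `N`, the random graph `A N` on `N` nodes is a directed stochastic block model with
block probability matrix `B` and random block membership function `τ N`. Nothing is assumed about
the joint law for different `N`. -/
structure IsDirectedSBM {Ω : Type*} [MeasurableSpace Ω] (P : Measure Ω) {K : ℕ}
    (B : Matrix (Fin K) (Fin K) ℝ) (τ : (N : ℕ) → Ω → Fin N → Fin K)
    (A : (N : ℕ) → Ω → Fin N → Fin N → Bool) : Prop where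
  measurable_labels : ∀ N, Measurable (τ N)
  measurable_edges : ∀ N, Measurable (A N)
  law : ∀ (N : ℕ) (t : Fin N → Fin K) (a : Fin N → Fin N → Bool),
    P {ω | τ N ω = t ∧ A N ω = a} =
      P {ω | τ N ω = t} * ENNReal.ofReal (edgeProbability B t a)

/-- The set of nodes in block `k`. -/
def block {N K : ℕ} (t : Fin N → Fin K) (k : Fin K) : Finset (Fin N) :=
  Finset.univ.filter fun u => t u = k

/-- The proportion `n_k / N` of nodes in block `k`. -/
noncomputable def proportion {N K : ℕ} (t : Fin N → Fin K) (k : Fin K) : ℝ :=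
  ((block t k).card : ℝ) / (N : ℝ)

/-- For every `N`, the block memberships are drawn independently from the distribution `π`. -/
def LabelsIID {Ω : Type*} [MeasurableSpace Ω] (P : Measure Ω) {K : ℕ} (π : Fin K → ℝ)
    (τ : (N : ℕ) → Ω → Fin N → Fin K) : Prop :=
  ∀ (N : ℕ) (t : Fin N → Fin K), P {ω | τ N ω = t} = ENNReal.ofReal (∏ u, π (t u))

/-- The block memberships have (asymptotic) proportions `π`, almost surely. In particular
this covers nonrandom memberships with block sizes `π k * N` up to rounding. -/
def LabelsHaveProportions {Ω : Type*} [MeasurableSpace Ω] (P : Measure Ω) {K : ℕ} (π : Fin K → ℝ)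
    (τ : (N : ℕ) → Ω → Fin N → Fin K) : Prop :=
  ∀ᵐ ω ∂P, ∀ k, Tendsto (fun N => proportion (τ N ω) k) atTop (𝓝 (π k))

/-- `A = L * diag σ * Rᵀ` is a singular value decomposition of the square matrix `A`, with the
singular values in decreasing order. -/
structure IsSVD {n : ℕ} (A L : Matrix (Fin n) (Fin n) ℝ) (σ : Fin n → ℝ)
    (R : Matrix (Fin n) (Fin n) ℝ) : Prop where
  left_orthogonal : L ∈ Matrix.orthogonalGroup (Fin n) ℝ
  right_orthogonal : R ∈ Matrix.orthogonalGroup (Fin n) ℝ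
  antitone : Antitone σ
  nonneg : ∀ i, 0 ≤ σ i
  eq : A = L * Matrix.diagonal σ * Rᵀ

/-- The columns of `U` and `V` are the left and right singular vectors of `A` for its `d` largest
singular values, for some singular value decomposition of `A`. -/
def IsTopSingularVectors {N d : ℕ} (A : Matrix (Fin N) (Fin N) ℝ)
    (U V : Matrix (Fin N) (Fin d) ℝ) : Prop :=
  ∃ (h : d ≤ N) (L : Matrix (Fin N) (Fin N) ℝ) (σ : Fin N → ℝ) (R : Matrix (Fin N) (Fin N) ℝ),
    IsSVD A L σ R ∧ U = L.submatrix id (Fin.castLE h) ∧ V = R.submatrix id (Fin.castLE h)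

/-- The `K`-means objective: the sum over `u` of `‖W_u - ν_{τ(u)}‖²` (Euclidean norm). -/
def kMeansCost {N K : ℕ} {ι : Type*} [Fintype ι] (W : Matrix (Fin N) ι ℝ)
    (ν : Fin K → ι → ℝ) (t : Fin N → Fin K) : ℝ :=
  ∑ u, ∑ j, (W u j - ν (t u) j) ^ 2

/-- `(ν, t)` minimises the `K`-means objective for the rows of `W`. -/
def IsKMeansSolution {N K : ℕ} {ι : Type*} [Fintype ι] (W : Matrix (Fin N) ι ℝ)
    (ν : Fin K → ι → ℝ) (t : Fin N → Fin K) : Prop :=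
  ∀ (ν' : Fin K → ι → ℝ) (t' : Fin N → Fin K), kMeansCost W ν t ≤ kMeansCost W ν' t'

/-- The number of misclustered nodes: the minimum over permutations `ρ` of the block names of the
number of nodes `u` with `t u ≠ ρ (t' u)`. -/
def misclustered {N K : ℕ} (t t' : Fin N → Fin K) : ℕ :=
  Finset.univ.inf' ⟨(1 : Equiv.Perm (Fin K)), Finset.mem_univ _⟩
    fun ρ : Equiv.Perm (Fin K) => (Finset.univ.filter fun u => t u ≠ ρ (t' u)).card

/-- `T₁ = ∑_{w ∈ G₁} (1 - x²) + ∑_{w ∈ G₂} (1 - s²)` for `x = r`, and `T₂` for `x = q`. -/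
def blockSum {N : ℕ} (t : Fin N → Fin 2) (x s : ℝ) : ℝ :=
  ∑ _w ∈ block t 0, (1 - x ^ 2) + ∑ _w ∈ block t 1, (1 - s ^ 2)

/-- The number `T` with `T N² = T₁² + T₂²`. -/
noncomputable def sampleT {N : ℕ} (t : Fin N → Fin 2) (q r s : ℝ) : ℝ :=
  (blockSum t r s ^ 2 + blockSum t q s ^ 2) / (N : ℝ) ^ 2

/-- The value of `T` when the blocks have proportions `π 0` and `π 1`. -/
def limitT (π : Fin 2 → ℝ) (q r s : ℝ) : ℝ :=
  (π 0 * (1 - r ^ 2) + π 1 * (1 - s ^ 2)) ^ 2 + (π 0 * (1 - q ^ 2) + π 1 * (1 - s ^ 2)) ^ 2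

/-- The bound `2² 3² 6 T / (β² (b π̃)⁵) · log N`. -/
noncomputable def aseBound (T β b πmin : ℝ) (N : ℕ) : ℝ :=
  2 ^ 2 * 3 ^ 2 * 6 * T / (β ^ 2 * (b * πmin) ^ 5) * Real.log N

/-! The number of misclustered nodes is in fact bounded: almost surely it is eventually at most a
constant depending only on `B` and `π`, and a positive multiple of `log N` exceeds that constant for
large `N`. The constants in `aseBound` therefore enter only through positivity and a lower bound on
them that is independent of `N`.

Noise: given the labels, a union bound over a net shows that `A` differs from its mean by at most
`20 √N` in operator norm, except with probability at most `(25 e⁻⁴) ^ N`. This is uniform in the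
labels and summable in `N`, so Borel-Cantelli applies without any assumption on the joint law for
different `N` (`IsDirectedSBM.ae_eventually_opNorm`). Under either label model every block
eventually has linear size (`ae_eventually_block_card`).

Signal: since `det B ≠ 0`, the expected matrix stretches block-constant vectors by a factor of order
`N`, so the second singular value of `A` has order `N` (`IsSVD.second_singular_value_lower`). Each
leading singular vector then lies within `O(1/√N)` of a block-constant vector
(`IsSVD.left_col_near_block`), and orthonormality forces the block values apart by order `1/√N`
(`separation_of_orthonormal`).

Clustering: the `K`-means cost at the block centers is `O(1/N)`, while each misplaced node costs a
multiple of the squared gap, also of order `1/N`. Hence only `O(1)` nodes are misplaced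
(`IsKMeansSolution.misclustered_le`, `misclustered_le_of_opNorm`). -/

/-! ### Nets and the operator norm. -/

section Net

/-- A finite-dimensional normed space has a `1`-net of the ball of radius `2` with at most `5 ^ d`
points. -/
lemma exists_finset_net (E : Type*) [NormedAddCommGroup E] [NormedSpace ℝ E]
    [FiniteDimensional ℝ E] :
    ∃ S : Finset E, S.card ≤ 5 ^ Module.finrank ℝ E ∧ (∀ c ∈ S, ‖c‖ ≤ 2) ∧
      ∀ x : E, ‖x‖ ≤ 2 → ∃ c ∈ S, ‖x - c‖ < 1 := by
  classical
  by_contra! h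
  -- Greedy packing: a separated set never exceeds `5 ^ d` points, so by `h` it is never a net and
  -- can always be enlarged, which contradicts the packing bound.
  have key : ∀ n : ℕ, ∃ S : Finset E, S.card = n ∧ (∀ c ∈ S, ‖c‖ ≤ 2) ∧
      ∀ c ∈ S, ∀ d ∈ S, c ≠ d → 1 ≤ ‖c - d‖ := by
    intro n
    induction n with
    | zero => exact ⟨∅, by simp⟩
    | succ n ih =>
      obtain ⟨S, hn, h2, hsep⟩ := ih
      obtain ⟨x, hx, hxS⟩ := h S (Besicovitch.card_le_of_separated S h2 hsep) h2
      have hxn : x ∉ S := fun hmem => by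
        have := hxS x hmem
        simp at this
        linarith
      refine ⟨insert x S, by rw [Finset.card_insert_of_notMem hxn, hn], ?_, ?_⟩
      · intro c hc
        rcases Finset.mem_insert.1 hc with rfl | hc
        · exact hx
        · exact h2 c hc
      · intro c hc d hd hcd
        rcases Finset.mem_insert.1 hc with hc | hc <;> rcases Finset.mem_insert.1 hd with hd | hd
        · exact absurd (hc.trans hd.symm) hcd
        · rw [hc]; exact hxS d hd
        · rw [hd, norm_sub_rev]; exact hxS c hc
        · exact hsep c hc d hd hcd
  obtain ⟨S, hn, h2, hsep⟩ := key (5 ^ Module.finrank ℝ E + 1)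
  have := Besicovitch.card_le_of_separated S h2 hsep
  omega

/-- The operator norm is at most the maximum of the bilinear form on a net. -/
lemma opNorm_le_of_net {E : Type*} [NormedAddCommGroup E] [InnerProductSpace ℝ E]
    (S : Finset E) (hS : ∀ x : E, ‖x‖ ≤ 2 → ∃ c ∈ S, ‖x - c‖ < 1) (T : E →L[ℝ] E) (m : ℝ)
    (hm : ∀ c ∈ S, ∀ d ∈ S, inner ℝ d (T c) ≤ m) : ‖T‖ ≤ m := by
  have h1 : ∀ c ∈ S, ‖T c‖ ≤ m := by
    intro c hc
    by_cases h0 : T c = 0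
    · obtain ⟨d, hd, -⟩ := hS 0 (by simp)
      have := hm c hc d hd
      rw [h0, inner_zero_right] at this
      rw [h0, norm_zero]
      exact this
    · have hpos : 0 < ‖T c‖ := norm_pos_iff.2 h0
      -- The multiple of `T c` of norm `2` pairs with `T c` to `2‖T c‖`; passing to a net point at
      -- distance below `1` loses at most half of this.
      obtain ⟨d, hd, hdist⟩ := hS ((2 / ‖T c‖) • T c) (by
        rw [norm_smul, Real.norm_eq_abs, abs_of_pos (by positivity)]
        exact (div_mul_cancel₀ _ hpos.ne').le)
      have h3 : inner ℝ ((2 / ‖T c‖) • T c) (T c) = 2 * ‖T c‖ := by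
        rw [real_inner_smul_left, real_inner_self_eq_norm_sq]
        field_simp
      have h4 : inner ℝ ((2 / ‖T c‖) • T c - d) (T c) ≤ 1 * ‖T c‖ :=
        (real_inner_le_norm _ _).trans (by gcongr)
      rw [inner_sub_left, h3] at h4
      linarith [hm c hc d hd]
  have hm0 : 0 ≤ m := by
    obtain ⟨d, hd, -⟩ := hS 0 (by simp)
    exact (norm_nonneg _).trans (h1 d hd)
  -- The discretization error is charged to `‖T‖` itself with factor `1/2` and then absorbed.
  have h2 : ‖T‖ ≤ (m + ‖T‖) / 2 := by
    refine T.opNorm_le_bound (by positivity) fun x => ?_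
    by_cases h0 : x = 0
    · simp [h0]
    have hpos : 0 < ‖x‖ := norm_pos_iff.2 h0
    obtain ⟨c, hc, hdist⟩ := hS ((2 / ‖x‖) • x) (by
      rw [norm_smul, Real.norm_eq_abs, abs_of_pos (by positivity)]
      exact (div_mul_cancel₀ _ hpos.ne').le)
    have h3 : ‖T ((2 / ‖x‖) • x)‖ ≤ m + ‖T‖ := by
      calc ‖T ((2 / ‖x‖) • x)‖ = ‖T c + T ((2 / ‖x‖) • x - c)‖ := by rw [← map_add]; simp
        _ ≤ ‖T c‖ + ‖T ((2 / ‖x‖) • x - c)‖ := norm_add_le _ _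
        _ ≤ m + ‖T‖ * 1 := add_le_add (h1 c hc) ((T.le_opNorm _).trans (by gcongr))
        _ = m + ‖T‖ := by ring
    rw [map_smul, norm_smul, Real.norm_eq_abs, abs_of_pos (by positivity)] at h3
    rw [div_mul_eq_mul_div, div_le_iff₀ hpos] at h3
    linarith
  linarith

/-- The matrix `M` has squared operator norm at most `m`. -/
def SqOpNormLE {n : ℕ} (M : Matrix (Fin n) (Fin n) ℝ) (m : ℝ) : Prop :=
  ∀ x : Fin n → ℝ, (M *ᵥ x) ⬝ᵥ (M *ᵥ x) ≤ m * (x ⬝ᵥ x)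

/-- The net is chosen before `M`, which allows a union bound over random matrices and lets one net
serve a matrix and its transpose. -/
lemma exists_matrix_net (n : ℕ) : ∃ S : Finset (Fin n → ℝ), S.card ≤ 5 ^ n ∧
    (∀ c ∈ S, ∑ i, c i ^ 2 ≤ 4) ∧
    ∀ (M : Matrix (Fin n) (Fin n) ℝ) (m : ℝ),
      (∀ c ∈ S, ∀ d ∈ S, ∑ i, ∑ j, d i * c j * M i j ≤ m) → SqOpNormLE M (m ^ 2) := by
  classical
  obtain ⟨S, hcard, h2, hS⟩ := exists_finset_net (EuclideanSpace ℝ (Fin n))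
  rw [finrank_euclideanSpace_fin] at hcard
  refine ⟨S.image WithLp.ofLp, Finset.card_image_le.trans hcard, ?_, ?_⟩
  · intro c hc
    obtain ⟨c, hcS, rfl⟩ := Finset.mem_image.1 hc
    have := h2 c hcS
    have h3 : ‖c‖ ^ 2 ≤ 2 ^ 2 := by gcongr
    rw [EuclideanSpace.real_norm_sq_eq] at h3
    linarith
  · intro M m hm x
    have hT := opNorm_le_of_net S hS (Matrix.toEuclideanCLM (𝕜 := ℝ) M) m (by
      intro c hc d hd
      refine le_trans (le_of_eq ?_) (hm _ (Finset.mem_image_of_mem _ hc) _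
        (Finset.mem_image_of_mem _ hd))
      simp only [PiLp.inner_apply, RCLike.inner_apply, conj_trivial, Matrix.ofLp_toEuclideanCLM,
        Matrix.mulVec, dotProduct, Finset.sum_mul]
      refine Finset.sum_congr rfl fun i _ => Finset.sum_congr rfl fun j _ => by ring)
    have h3 : ‖Matrix.toEuclideanCLM (𝕜 := ℝ) M (WithLp.toLp 2 x)‖ ^ 2
        ≤ (m * ‖WithLp.toLp 2 x‖) ^ 2 := by
      gcongr
      exact (ContinuousLinearMap.le_opNorm _ _).trans (by gcongr)
    rw [mul_pow, EuclideanSpace.real_norm_sq_eq, EuclideanSpace.real_norm_sq_eq] at h3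
    simpa [dotProduct, sq] using h3

end Net

/-! ### Exponential tail of the noise, conditionally on the labels. -/

section Tail

/-- The linear term averages to zero for a centered variable, leaving a sub-Gaussian bound. -/
lemma exp_le_add_exp_sq (x : ℝ) : Real.exp x ≤ x + Real.exp (x ^ 2) := by
  have h1 := Real.add_one_le_exp (x ^ 2)
  rcases le_or_gt |x| 1 with h | h
  · have := (abs_le.1 (Real.abs_exp_sub_one_sub_id_le h)).2
    linarith
  · rcases lt_abs.1 h with h | h
    · have : Real.exp x ≤ Real.exp (x ^ 2) := Real.exp_le_exp.2 (by nlinarith)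
      linarith
    · have : Real.exp x ≤ 1 := Real.exp_le_one_iff.2 (by linarith)
      nlinarith

/-- The moment generating function of a centered Bernoulli variable. -/
lemma bernoulli_mgf_le {m : ℝ} (h0 : 0 ≤ m) (h1 : m ≤ 1) (c : ℝ) :
    m * Real.exp (c * (1 - m)) + (1 - m) * Real.exp (c * (0 - m)) ≤ Real.exp (c ^ 2) := by
  have ha := exp_le_add_exp_sq (c * (1 - m))
  have hb := exp_le_add_exp_sq (c * (0 - m))
  have ha' : Real.exp ((c * (1 - m)) ^ 2) ≤ Real.exp (c ^ 2) := by
    refine Real.exp_le_exp.2 ?_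
    rw [mul_pow]
    exact mul_le_of_le_one_right (sq_nonneg c) (by nlinarith)
  have hb' : Real.exp ((c * (0 - m)) ^ 2) ≤ Real.exp (c ^ 2) := by
    refine Real.exp_le_exp.2 ?_
    rw [mul_pow]
    exact mul_le_of_le_one_right (sq_nonneg c) (by nlinarith)
  have h1m : 0 ≤ 1 - m := by linarith
  have e1 := mul_le_mul_of_nonneg_left (ha.trans (add_le_add_right ha' _)) h0
  have e2 := mul_le_mul_of_nonneg_left (hb.trans (add_le_add_right hb' _)) h1m
  nlinarith

/-- The conditional mean of the adjacency matrix given the block memberships. -/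
def meanMatrix {N K : ℕ} (B : Matrix (Fin K) (Fin K) ℝ) (t : Fin N → Fin K) :
    Matrix (Fin N) (Fin N) ℝ :=
  Matrix.of fun i j => if i = j then 0 else B (t i) (t j)

lemma sum_prod_prod_bool {N : ℕ} (f : Fin N → Fin N → Bool → ℝ) :
    ∑ a : Fin N → Fin N → Bool, ∏ i, ∏ j, f i j (a i j) =
      ∏ i, ∏ j, (f i j true + f i j false) := by
  have h : ∀ g : Fin N → Bool → ℝ, ∏ j, (g j true + g j false) =
      ∑ v : Fin N → Bool, ∏ j, g j (v j) := by
    intro g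
    have := Finset.prod_univ_sum (fun _ : Fin N => (Finset.univ : Finset Bool)) g
    rw [Fintype.piFinset_univ] at this
    rw [← this]
    simp
  simp_rw [h]
  have := Finset.prod_univ_sum (fun _ : Fin N => (Finset.univ : Finset (Fin N → Bool)))
    fun i v => ∏ j, f i j (v j)
  rw [Fintype.piFinset_univ] at this
  rw [this]

variable {N K : ℕ} {B : Matrix (Fin K) (Fin K) ℝ}

lemma edgeProbability_nonneg (hB : ∀ k l, 0 ≤ B k l ∧ B k l ≤ 1) (t : Fin N → Fin K)
    (a : Fin N → Fin N → Bool) : 0 ≤ edgeProbability B t a := by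
  refine Finset.prod_nonneg fun i _ => Finset.prod_nonneg fun j _ => ?_
  have := hB (t i) (t j)
  split_ifs <;> linarith

/-- Independence of the entries turns the sum over graphs into a product of one-entry sums; each
diagonal factor is `1`. -/
lemma edgeProbability_mgf_le (hB : ∀ k l, 0 ≤ B k l ∧ B k l ≤ 1) (t : Fin N → Fin K)
    (c : Fin N → Fin N → ℝ) :
    ∑ a, edgeProbability B t a *
      Real.exp (∑ i, ∑ j, c i j * (adjacencyMatrix a - meanMatrix B t) i j) ≤
      Real.exp (∑ i, ∑ j, c i j ^ 2) := by
  have h := sum_prod_prod_bool fun i j b =>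
    (if i = j then (if b then 0 else 1) else (if b then B (t i) (t j) else 1 - B (t i) (t j))) *
      Real.exp (c i j * ((if b then 1 else 0) - if i = j then 0 else B (t i) (t j)))
  simp only [Finset.prod_mul_distrib, ← Real.exp_sum] at h
  simp only [edgeProbability, adjacencyMatrix, meanMatrix, Matrix.sub_apply, Matrix.of_apply]
  rw [h, Real.exp_sum]
  refine Finset.prod_le_prod (fun i _ => ?_) fun i _ => ?_
  · refine Finset.prod_nonneg fun j _ => ?_
    have := hB (t i) (t j)
    by_cases hij : i = j
    · simp [hij]
    · simp only [hij, if_false, if_true, Bool.false_eq_true]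
      exact add_nonneg (mul_nonneg this.1 (Real.exp_pos _).le)
        (mul_nonneg (by linarith) (Real.exp_pos _).le)
  · rw [Real.exp_sum]
    refine Finset.prod_le_prod (fun j _ => ?_) fun j _ => ?_
    · have := hB (t i) (t j)
      by_cases hij : i = j
      · simp [hij]
      · simp only [hij, if_false, if_true, Bool.false_eq_true]
        exact add_nonneg (mul_nonneg this.1 (Real.exp_pos _).le)
          (mul_nonneg (by linarith) (Real.exp_pos _).le)
    · have := hB (t i) (t j)
      by_cases hij : i = j
      · simp [hij, sq_nonneg]
      · simp only [hij, if_false, if_true, Bool.false_eq_true]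
        exact bernoulli_mgf_le this.1 this.2 _

lemma sum_biUnion_le {ι α : Type*} [DecidableEq α] (s : Finset ι) (u : ι → Finset α)
    (f : α → ℝ) (hf : ∀ a, 0 ≤ f a) : ∑ a ∈ s.biUnion u, f a ≤ ∑ z ∈ s, ∑ a ∈ u z, f a := by
  classical
  induction s using Finset.induction_on with
  | empty => simp
  | insert z s hz ih =>
    rw [Finset.biUnion_insert, Finset.sum_insert hz]
    have := Finset.sum_union_inter (s₁ := u z) (s₂ := s.biUnion u) (f := f)
    have h0 : 0 ≤ ∑ a ∈ u z ∩ s.biUnion u, f a := Finset.sum_nonneg fun a _ => hf a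
    linarith

-- Chernoff's bound with parameter `√N`: the threshold contributes `20 N` to the exponent and the
-- moment generating function at most `16 N`.
open Classical in
lemma edgeProbability_linear_tail (hB : ∀ k l, 0 ≤ B k l ∧ B k l ≤ 1) (t : Fin N → Fin K)
    (c d : Fin N → ℝ) (hc : ∑ i, c i ^ 2 ≤ 4) (hd : ∑ i, d i ^ 2 ≤ 4) :
    ∑ a with 20 * √N < ∑ i, ∑ j, d i * c j * (adjacencyMatrix a - meanMatrix B t) i j,
      edgeProbability B t a ≤ Real.exp (-4 * N) := by
  have hmgf := edgeProbability_mgf_le hB t fun i j => √N * (d i * c j)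
  have hN : √(N : ℝ) * √N = N := Real.mul_self_sqrt (Nat.cast_nonneg N)
  have hsum : ∑ i, ∑ j, (√(N : ℝ) * (d i * c j)) ^ 2 ≤ 16 * N := by
    have : ∑ i, ∑ j, (√(N : ℝ) * (d i * c j)) ^ 2 = N * ((∑ i, d i ^ 2) * ∑ j, c j ^ 2) := by
      rw [Finset.sum_mul_sum, Finset.mul_sum]
      refine Finset.sum_congr rfl fun i _ => ?_
      rw [Finset.mul_sum]
      refine Finset.sum_congr rfl fun j _ => ?_
      rw [mul_pow, Real.sq_sqrt (Nat.cast_nonneg N), mul_pow]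
    rw [this]
    have h16 : (∑ i, d i ^ 2) * ∑ j, c j ^ 2 ≤ 4 * 4 :=
      mul_le_mul hd hc (Finset.sum_nonneg fun _ _ => sq_nonneg _) (by norm_num)
    have := mul_le_mul_of_nonneg_left h16 (Nat.cast_nonneg (α := ℝ) N)
    linarith
  have key : Real.exp (20 * N) *
      ∑ a with 20 * √N < ∑ i, ∑ j, d i * c j * (adjacencyMatrix a - meanMatrix B t) i j,
        edgeProbability B t a ≤ Real.exp (16 * N) := by
    refine le_trans ?_ (hmgf.trans (Real.exp_le_exp.2 hsum))
    rw [Finset.mul_sum]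
    refine le_trans (Finset.sum_le_sum fun a ha => ?_) (Finset.sum_le_sum_of_subset_of_nonneg
      (Finset.filter_subset _ _) fun a _ _ =>
        mul_nonneg (edgeProbability_nonneg hB t a) (Real.exp_pos _).le)
    rw [mul_comm]
    refine mul_le_mul_of_nonneg_left (Real.exp_le_exp.2 ?_) (edgeProbability_nonneg hB t a)
    have h := (Finset.mem_filter.1 ha).2
    calc 20 * (N : ℝ) = √N * (20 * √N) := by linear_combination -20 * hN
      _ ≤ √N * ∑ i, ∑ j, d i * c j * (adjacencyMatrix a - meanMatrix B t) i j := by gcongr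
      _ = _ := by
        simp only [Finset.mul_sum]
        exact Finset.sum_congr rfl fun i _ => Finset.sum_congr rfl fun j _ => by ring
  have h2 : Real.exp (16 * N) = Real.exp (20 * N) * Real.exp (-4 * N) := by
    rw [← Real.exp_add]; congr 1; ring
  rw [h2] at key
  exact le_of_mul_le_mul_left key (Real.exp_pos _)

open Classical in
/-- The adjacency matrix deviates from its conditional mean by more than `20 √N` in operator norm
with exponentially small conditional probability. -/
lemma edgeProbability_opNorm_tail (hB : ∀ k l, 0 ≤ B k l ∧ B k l ≤ 1) (t : Fin N → Fin K) :
    ∑ a with ¬ (SqOpNormLE (adjacencyMatrix a - meanMatrix B t) (400 * N) ∧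
        SqOpNormLE (adjacencyMatrix a - meanMatrix B t)ᵀ (400 * N)),
      edgeProbability B t a ≤ (25 * Real.exp (-4)) ^ N := by
  obtain ⟨S, hcard, h4, hS⟩ := exists_matrix_net N
  have hsub : (Finset.univ.filter fun a =>
      ¬ (SqOpNormLE (adjacencyMatrix a - meanMatrix B t) (400 * N) ∧
        SqOpNormLE (adjacencyMatrix a - meanMatrix B t)ᵀ (400 * N))) ⊆
      (S ×ˢ S).biUnion fun z => Finset.univ.filter fun a =>
        20 * √N < ∑ i, ∑ j, z.2 i * z.1 j * (adjacencyMatrix a - meanMatrix B t) i j := by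
    intro a ha
    by_contra hcon
    simp only [Finset.mem_biUnion, Finset.mem_product, Finset.mem_filter, Finset.mem_univ,
      true_and, not_exists, not_and, not_lt, Prod.forall] at hcon
    refine (Finset.mem_filter.1 ha).2 ?_
    have h400 : (20 * √(N : ℝ)) ^ 2 = 400 * N := by
      rw [mul_pow, Real.sq_sqrt (Nat.cast_nonneg N)]; norm_num
    rw [← h400]
    refine ⟨hS _ _ fun c hc d hd => hcon c d ⟨hc, hd⟩, hS _ _ fun c hc d hd => ?_⟩
    refine le_trans (le_of_eq ?_) (hcon d c ⟨hd, hc⟩)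
    rw [Finset.sum_comm]
    exact Finset.sum_congr rfl fun i _ => Finset.sum_congr rfl fun j _ => by
      rw [Matrix.transpose_apply]; ring
  calc _ ≤ ∑ a ∈ (S ×ˢ S).biUnion fun z => Finset.univ.filter fun a =>
        20 * √N < ∑ i, ∑ j, z.2 i * z.1 j * (adjacencyMatrix a - meanMatrix B t) i j,
        edgeProbability B t a :=
        Finset.sum_le_sum_of_subset_of_nonneg hsub fun a _ _ => edgeProbability_nonneg hB t a
    _ ≤ ∑ z ∈ S ×ˢ S, ∑ a with
        20 * √N < ∑ i, ∑ j, z.2 i * z.1 j * (adjacencyMatrix a - meanMatrix B t) i j,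
        edgeProbability B t a :=
        sum_biUnion_le _ _ _ fun a => edgeProbability_nonneg hB t a
    _ ≤ ∑ z ∈ S ×ˢ S, Real.exp (-4 * N) := Finset.sum_le_sum fun z hz =>
        edgeProbability_linear_tail hB t z.1 z.2 (h4 _ (Finset.mem_product.1 hz).1)
          (h4 _ (Finset.mem_product.1 hz).2)
    _ = (S.card * S.card : ℝ) * Real.exp (-4 * N) := by
        rw [Finset.sum_const, Finset.card_product, nsmul_eq_mul]; push_cast; ring
    _ ≤ (5 ^ N * 5 ^ N : ℝ) * Real.exp (-4 * N) := by
        have : (S.card : ℝ) ≤ 5 ^ N := by exact_mod_cast hcard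
        gcongr
    _ = (25 * Real.exp (-4)) ^ N := by
        rw [mul_pow, ← mul_pow, ← Real.exp_nat_mul]; norm_num [mul_comm]

end Tail

/-! ### From conditional bounds to almost sure statements. -/

section Probability

/-- The Borel-Cantelli lemma for events with exponentially small probabilities. -/
lemma ae_eventually_of_geometric {Ω : Type*} [MeasurableSpace Ω] {P : Measure Ω}
    {Q : ℕ → Ω → Prop} {ρ : ℝ} (h0 : 0 ≤ ρ) (h1 : ρ < 1)
    (h : ∀ N, P {ω | ¬ Q N ω} ≤ ENNReal.ofReal (ρ ^ N)) :
    ∀ᵐ ω ∂P, ∀ᶠ N in atTop, Q N ω := by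
  have hsum : ∑' N, P {ω | ¬ Q N ω} ≠ ⊤ := by
    refine ne_top_of_le_ne_top ?_ (ENNReal.tsum_le_tsum h)
    rw [← ENNReal.ofReal_tsum_of_nonneg (fun N => pow_nonneg h0 N)
      (summable_geometric_of_lt_one h0 h1)]
    exact ENNReal.ofReal_ne_top
  filter_upwards [ae_eventually_notMem hsum] with ω hω
  filter_upwards [hω] with N hN
  by_contra hcon
  exact hN hcon

variable {Ω : Type*} [MeasurableSpace Ω] {P : Measure Ω} [IsProbabilityMeasure P] {K : ℕ}

open Classical in
/-- A conditional probability bound that is uniform in the block memberships holds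
unconditionally. -/
lemma IsDirectedSBM.measure_le {B : Matrix (Fin K) (Fin K) ℝ} {τ : (N : ℕ) → Ω → Fin N → Fin K}
    {A : (N : ℕ) → Ω → Fin N → Fin N → Bool} (h : IsDirectedSBM P B τ A)
    (hB : ∀ k l, 0 ≤ B k l ∧ B k l ≤ 1) (N : ℕ)
    (Q : (Fin N → Fin K) → (Fin N → Fin N → Bool) → Prop) (ε : ℝ)
    (hQ : ∀ t, ∑ a with Q t a, edgeProbability B t a ≤ ε) :
    P {ω | Q (τ N ω) (A N ω)} ≤ ENNReal.ofReal ε := by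
  have hsub : {ω | Q (τ N ω) (A N ω)} ⊆ ⋃ t ∈ (Finset.univ : Finset (Fin N → Fin K)),
      ⋃ a ∈ Finset.univ.filter (Q t), {ω | τ N ω = t ∧ A N ω = a} := by
    intro ω hω
    simp only [Set.mem_iUnion]
    exact ⟨τ N ω, Finset.mem_univ _, A N ω, by simpa using hω, rfl, rfl⟩
  have htotal : ∑ t : Fin N → Fin K, P {ω | τ N ω = t} ≤ 1 := by
    have := measure_biUnion_finset (μ := P) (s := (Finset.univ : Finset (Fin N → Fin K)))
      (f := fun t => {ω | τ N ω = t}) (by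
        intro t _ t' _ htt'
        exact Set.disjoint_left.2 fun ω h1 h2 => htt' (h1.symm.trans h2))
      (fun t _ => h.measurable_labels N (measurableSet_singleton t))
    rw [← this]
    exact prob_le_one
  calc P {ω | Q (τ N ω) (A N ω)}
      ≤ ∑ t : Fin N → Fin K, ∑ a with Q t a, P {ω | τ N ω = t ∧ A N ω = a} := by
        refine (measure_mono hsub).trans ((measure_biUnion_finset_le _ _).trans ?_)
        exact Finset.sum_le_sum fun t _ => measure_biUnion_finset_le _ _
    _ = ∑ t : Fin N → Fin K,
          P {ω | τ N ω = t} * ENNReal.ofReal (∑ a with Q t a, edgeProbability B t a) := by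
        refine Finset.sum_congr rfl fun t _ => ?_
        rw [ENNReal.ofReal_sum_of_nonneg fun a _ => edgeProbability_nonneg hB t a, Finset.mul_sum]
        exact Finset.sum_congr rfl fun a _ => h.law N t a
    _ ≤ ∑ t : Fin N → Fin K, P {ω | τ N ω = t} * ENNReal.ofReal ε :=
        Finset.sum_le_sum fun t _ => by gcongr; exact hQ t
    _ ≤ 1 * ENNReal.ofReal ε := by rw [← Finset.sum_mul]; gcongr
    _ = ENNReal.ofReal ε := one_mul _

lemma IsDirectedSBM.ae_eventually_opNorm {B : Matrix (Fin K) (Fin K) ℝ}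
    {τ : (N : ℕ) → Ω → Fin N → Fin K} {A : (N : ℕ) → Ω → Fin N → Fin N → Bool}
    (h : IsDirectedSBM P B τ A) (hB : ∀ k l, 0 ≤ B k l ∧ B k l ≤ 1) :
    ∀ᵐ ω ∂P, ∀ᶠ N in atTop,
      SqOpNormLE (adjacencyMatrix (A N ω) - meanMatrix B (τ N ω)) (400 * N) ∧
      SqOpNormLE (adjacencyMatrix (A N ω) - meanMatrix B (τ N ω))ᵀ (400 * N) := by
  -- The `25` counts pairs of net points, `5 ^ N` for each vector.
  have hρ : 25 * Real.exp (-4) < 1 := by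
    have h1 : (2.5 : ℝ) < Real.exp 1 := by have := Real.exp_one_gt_d9; linarith
    have h4 : Real.exp 4 = Real.exp 1 ^ 4 := by rw [← Real.exp_nat_mul]; norm_num
    have h5 : (2.5 : ℝ) ^ 4 < Real.exp 4 := by rw [h4]; gcongr
    rw [Real.exp_neg, ← div_eq_mul_inv, div_lt_one (Real.exp_pos _)]
    norm_num at h5
    linarith
  refine ae_eventually_of_geometric (by positivity) hρ fun N => ?_
  exact h.measure_le hB N (fun t a => ¬ (SqOpNormLE (adjacencyMatrix a - meanMatrix B t) (400 * N) ∧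
    SqOpNormLE (adjacencyMatrix a - meanMatrix B t)ᵀ (400 * N))) _
    fun t => by convert edgeProbability_opNorm_tail hB t

lemma block_card_eq_sum {N : ℕ} (t : Fin N → Fin K) (k : Fin K) :
    ((block t k).card : ℝ) = ∑ u, if t u = k then 1 else 0 := by
  simp [block]

lemma sum_prod_label {N : ℕ} (f : Fin K → ℝ) :
    ∑ t : Fin N → Fin K, ∏ u, f (t u) = (∑ l, f l) ^ N := by
  have := Finset.prod_univ_sum (fun _ : Fin N => (Finset.univ : Finset (Fin K))) fun _ l => f l
  rw [Fintype.piFinset_univ] at this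
  rw [← this]
  simp

open Classical in
/-- Chernoff's bound for the size of a block with independent memberships. -/
lemma block_card_tail {π : Fin K → ℝ} (hπ : ∀ k, 0 ≤ π k) (hsum : ∑ k, π k = 1) (k : Fin K)
    (N : ℕ) :
    ∑ t : Fin N → Fin K with ((block t k).card : ℝ) < π k / 2 * N, ∏ u, π (t u) ≤
      Real.exp (π k * (Real.exp (-1) - 1 / 2)) ^ N := by
  have h0 : ∀ t : Fin N → Fin K, 0 ≤ ∏ u, π (t u) := fun t => Finset.prod_nonneg fun u _ => hπ _
  calc _ ≤ ∑ t : Fin N → Fin K with ((block t k).card : ℝ) < π k / 2 * N,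
        (∏ u, π (t u)) * Real.exp (π k / 2 * N - (block t k).card) := by
        refine Finset.sum_le_sum fun t ht => le_mul_of_one_le_right (h0 t) ?_
        have := (Finset.mem_filter.1 ht).2
        exact Real.one_le_exp (by linarith)
    _ ≤ ∑ t : Fin N → Fin K, (∏ u, π (t u)) * Real.exp (π k / 2 * N - (block t k).card) :=
        Finset.sum_le_sum_of_subset_of_nonneg (Finset.filter_subset _ _) fun t _ _ =>
          mul_nonneg (h0 t) (Real.exp_pos _).le
    _ = Real.exp (π k / 2 * N) *
          ∑ t : Fin N → Fin K, ∏ u, (π (t u) * Real.exp (-(if t u = k then 1 else 0))) := by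
        rw [Finset.mul_sum]
        refine Finset.sum_congr rfl fun t _ => ?_
        rw [block_card_eq_sum, sub_eq_add_neg, Real.exp_add, ← Finset.sum_neg_distrib,
          Real.exp_sum, Finset.prod_mul_distrib]
        ring
    _ = (Real.exp (π k / 2) * ∑ l, π l * Real.exp (-(if l = k then 1 else 0))) ^ N := by
        rw [sum_prod_label fun l => π l * Real.exp (-(if l = k then 1 else 0)), mul_pow,
          ← Real.exp_nat_mul, mul_comm (N : ℝ)]
    _ ≤ _ := by
        have hs : ∑ l, π l * Real.exp (-(if l = k then 1 else 0)) =
            π k * (Real.exp (-1) - 1) + 1 := by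
          have : ∀ l, π l * Real.exp (-(if l = k then 1 else 0)) =
              (if l = k then π l * (Real.exp (-1) - 1) else 0) + π l := by
            intro l
            split_ifs
            · ring
            · simp
          simp_rw [this, Finset.sum_add_distrib, hsum]
          simp
        refine pow_le_pow_left₀ (mul_nonneg (Real.exp_pos _).le (Finset.sum_nonneg fun l _ =>
          mul_nonneg (hπ l) (Real.exp_pos _).le)) ?_ N
        rw [hs]
        refine (mul_le_mul_of_nonneg_left (Real.add_one_le_exp _) (Real.exp_pos _).le).trans ?_
        rw [← Real.exp_add]
        exact Real.exp_le_exp.2 (by linarith)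

end Probability

lemma ae_eventually_block_card {Ω : Type*} [MeasurableSpace Ω] {P : Measure Ω} {K : ℕ}
    {π : Fin K → ℝ} (hπ : ∀ k, 0 < π k) (hsum : ∑ k, π k = 1)
    {τ : (N : ℕ) → Ω → Fin N → Fin K}
    (hτ : LabelsIID P π τ ∨ LabelsHaveProportions P π τ) (k : Fin K) :
    ∀ᵐ ω ∂P, ∀ᶠ N : ℕ in atTop, π k / 2 * N ≤ (block (τ N ω) k).card := by
  classical
  rcases hτ with hτ | hτ
  -- This makes the Chernoff rate in `block_card_tail` negative.
  · have he : Real.exp (-1) < 1 / 2 := by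
      rw [Real.exp_neg, ← one_div]
      have := Real.exp_one_gt_d9
      exact one_div_lt_one_div_of_lt (by norm_num) (by linarith)
    refine ae_eventually_of_geometric (ρ := Real.exp (π k * (Real.exp (-1) - 1 / 2)))
      (Real.exp_pos _).le (Real.exp_lt_one_iff.2 (mul_neg_of_pos_of_neg (hπ k) (by linarith)))
      fun N => ?_
    have hsub : {ω | ¬ π k / 2 * N ≤ (block (τ N ω) k).card} ⊆
        ⋃ t ∈ Finset.univ.filter fun t : Fin N → Fin K =>
          ((block t k).card : ℝ) < π k / 2 * N, {ω | τ N ω = t} := by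
      intro ω hω
      simp only [Set.mem_iUnion]
      exact ⟨τ N ω, by simpa using hω, rfl⟩
    refine (measure_mono hsub).trans ((measure_biUnion_finset_le _ _).trans ?_)
    simp_rw [hτ N]
    rw [← ENNReal.ofReal_sum_of_nonneg fun t _ => Finset.prod_nonneg fun u _ => (hπ _).le]
    exact ENNReal.ofReal_le_ofReal (block_card_tail (fun k => (hπ k).le) hsum k N)
  · filter_upwards [hτ] with ω hω
    filter_upwards [(hω k).eventually (lt_mem_nhds (half_lt_self (hπ k))), eventually_gt_atTop 0]
      with N hN h0
    have h0' : (0 : ℝ) < N := by exact_mod_cast h0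
    exact ((lt_div_iff₀ h0').1 hN).le

/-! ### Singular values and singular vectors of a perturbed block matrix. -/

section Deterministic

lemma dotProduct_self_add_le {n : ℕ} (x y : Fin n → ℝ) :
    (x + y) ⬝ᵥ (x + y) ≤ 2 * (x ⬝ᵥ x) + 2 * (y ⬝ᵥ y) := by
  simp only [dotProduct, Finset.mul_sum, ← Finset.sum_add_distrib, Pi.add_apply]
  exact Finset.sum_le_sum fun i _ => by nlinarith [sq_nonneg (x i - y i)]

lemma SqOpNormLE.add {n : ℕ} {M M' : Matrix (Fin n) (Fin n) ℝ} {m m' : ℝ} (h : SqOpNormLE M m)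
    (h' : SqOpNormLE M' m') : SqOpNormLE (M + M') (2 * m + 2 * m') := by
  intro x
  rw [Matrix.add_mulVec]
  have := dotProduct_self_add_le (M *ᵥ x) (M' *ᵥ x)
  have := h x
  have := h' x
  linarith

lemma sqOpNormLE_diagonal {n : ℕ} {v : Fin n → ℝ} {m : ℝ} (h : ∀ i, v i ^ 2 ≤ m) :
    SqOpNormLE (Matrix.diagonal v) m := by
  intro x
  simp only [Matrix.mulVec_diagonal, dotProduct, Finset.mul_sum]
  exact Finset.sum_le_sum fun i _ => by nlinarith [h i, mul_self_nonneg (x i)]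

/-- The matrix of the edge probabilities, including the diagonal. -/
def blockMatrix {N K : ℕ} (B : Matrix (Fin K) (Fin K) ℝ) (t : Fin N → Fin K) :
    Matrix (Fin N) (Fin N) ℝ :=
  Matrix.of fun i j => B (t i) (t j)

lemma meanMatrix_eq {N K : ℕ} (B : Matrix (Fin K) (Fin K) ℝ) (t : Fin N → Fin K) :
    meanMatrix B t = blockMatrix B t + Matrix.diagonal fun i => -B (t i) (t i) := by
  ext i j
  by_cases h : i = j
  · subst h; simp [meanMatrix, blockMatrix]
  · simp [meanMatrix, blockMatrix, h]

lemma sqOpNormLE_sub_blockMatrix {N K : ℕ} {B : Matrix (Fin K) (Fin K) ℝ}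
    (hB : ∀ k l, 0 ≤ B k l ∧ B k l ≤ 1) (t : Fin N → Fin K) (M : Matrix (Fin N) (Fin N) ℝ) {m : ℝ}
    (h : SqOpNormLE (M - meanMatrix B t) m ∧ SqOpNormLE (M - meanMatrix B t)ᵀ m) :
    SqOpNormLE (M - blockMatrix B t) (2 * m + 2 * 1) ∧
      SqOpNormLE (M - blockMatrix B t)ᵀ (2 * m + 2 * 1) := by
  have hd : SqOpNormLE (Matrix.diagonal fun i => -B (t i) (t i)) 1 :=
    sqOpNormLE_diagonal fun i => by nlinarith [hB (t i) (t i)]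
  have e : M - blockMatrix B t =
      M - meanMatrix B t + Matrix.diagonal fun i => -B (t i) (t i) := by
    rw [meanMatrix_eq]; abel
  rw [e]
  refine ⟨h.1.add hd, ?_⟩
  rw [Matrix.transpose_add, Matrix.diagonal_transpose]
  exact h.2.add hd

lemma sum_comp_label {N : ℕ} (t : Fin N → Fin 2) (f : Fin 2 → ℝ) :
    ∑ u, f (t u) = (block t 0).card * f 0 + (block t 1).card * f 1 := by
  have h : ∀ u, f (t u) = (if t u = 0 then 1 else 0) * f 0 + (if t u = 1 then 1 else 0) * f 1 := by
    intro u
    rcases Fin.exists_fin_two.1 ⟨t u, rfl⟩ with h | h <;> simp [h]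
  rw [Finset.sum_congr rfl fun u _ => h u, Finset.sum_add_distrib, ← Finset.sum_mul,
    ← Finset.sum_mul, ← block_card_eq_sum, ← block_card_eq_sum]

/-- On vectors which are constant on blocks, the block matrix is bounded below. -/
lemma blockMatrix_lower {N : ℕ} {B : Matrix (Fin 2) (Fin 2) ℝ}
    (hB : ∀ k l, 0 ≤ B k l ∧ B k l ≤ 1) (t : Fin N → Fin 2) {n₀ : ℝ} (hn₀ : 0 ≤ n₀)
    (hn : ∀ k, n₀ ≤ (block t k).card) (a : Fin 2 → ℝ) :
    n₀ ^ 2 * (B.det ^ 2 / 4) * ((a ∘ t) ⬝ᵥ (a ∘ t)) ≤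
      (blockMatrix B t *ᵥ (a ∘ t)) ⬝ᵥ (blockMatrix B t *ᵥ (a ∘ t)) := by
  set n := fun k => ((block t k).card : ℝ) with hndef
  set y : Fin 2 → ℝ := fun k => n k * a k with hy
  set w : Fin 2 → ℝ := B *ᵥ y with hw
  have hPx : blockMatrix B t *ᵥ (a ∘ t) = w ∘ t := by
    ext i
    simp only [blockMatrix, Matrix.mulVec, dotProduct, Matrix.of_apply, Function.comp, hw]
    rw [sum_comp_label t fun l => B (t i) l * a l, Fin.sum_univ_two]
    simp only [hy, hndef]
    ring
  have hdot : ∀ f : Fin 2 → ℝ, (f ∘ t) ⬝ᵥ (f ∘ t) = n 0 * f 0 ^ 2 + n 1 * f 1 ^ 2 := by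
    intro f
    simp only [dotProduct, Function.comp]
    rw [sum_comp_label t fun l => f l * f l]
    simp only [hndef]
    ring
  rw [hPx, hdot, hdot]
  have hw0 : w 0 = B 0 0 * y 0 + B 0 1 * y 1 := by
    simp [hw]
  have hw1 : w 1 = B 1 0 * y 0 + B 1 1 * y 1 := by
    simp [hw]
  -- Cramer's rule bounds `y` by `w = B y`, since the entries of the adjugate are at most `1` in
  -- absolute value.
  have hd0 : B.det * y 0 = B 1 1 * w 0 - B 0 1 * w 1 := by
    rw [hw0, hw1, Matrix.det_fin_two]; ring
  have hd1 : B.det * y 1 = B 0 0 * w 1 - B 1 0 * w 0 := by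
    rw [hw0, hw1, Matrix.det_fin_two]; ring
  have aux : ∀ x z c d : ℝ, 0 ≤ x → x ≤ 1 → 0 ≤ z → z ≤ 1 →
      (x * c - z * d) ^ 2 ≤ 2 * (c ^ 2 + d ^ 2) := by
    intro x z c d hx hx1 hz hz1
    have h1 : (x * c) ^ 2 ≤ c ^ 2 := by
      rw [mul_pow]; exact mul_le_of_le_one_left (sq_nonneg c) (by nlinarith)
    have h2 : (z * d) ^ 2 ≤ d ^ 2 := by
      rw [mul_pow]; exact mul_le_of_le_one_left (sq_nonneg d) (by nlinarith)
    nlinarith [sq_nonneg (x * c + z * d)]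
  have h0 : (B.det * y 0) ^ 2 ≤ 2 * (w 0 ^ 2 + w 1 ^ 2) := by
    rw [hd0]; exact aux _ _ _ _ (hB 1 1).1 (hB 1 1).2 (hB 0 1).1 (hB 0 1).2
  have h1 : (B.det * y 1) ^ 2 ≤ 2 * (w 1 ^ 2 + w 0 ^ 2) := by
    rw [hd1]; exact aux _ _ _ _ (hB 0 0).1 (hB 0 0).2 (hB 1 0).1 (hB 1 0).2
  have hsum : B.det ^ 2 / 4 * (y 0 ^ 2 + y 1 ^ 2) ≤ w 0 ^ 2 + w 1 ^ 2 := by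
    rw [mul_pow] at h0 h1; linarith
  have hn0 : n₀ ≤ n 0 := hn 0
  have hn1 : n₀ ≤ n 1 := hn 1
  have hk : ∀ k, n₀ ≤ n k → n₀ * (n k * a k ^ 2) ≤ y k ^ 2 := by
    intro k hk
    have : y k ^ 2 = n k * (n k * a k ^ 2) := by simp only [hy]; ring
    rw [this]
    exact mul_le_mul_of_nonneg_right hk (mul_nonneg (hn₀.trans hk) (sq_nonneg _))
  calc n₀ ^ 2 * (B.det ^ 2 / 4) * (n 0 * a 0 ^ 2 + n 1 * a 1 ^ 2)
      = n₀ * (B.det ^ 2 / 4 * (n₀ * (n 0 * a 0 ^ 2) + n₀ * (n 1 * a 1 ^ 2))) := by ring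
    _ ≤ n₀ * (B.det ^ 2 / 4 * (y 0 ^ 2 + y 1 ^ 2)) := by
        have := hk 0 hn0
        have := hk 1 hn1
        gcongr
    _ ≤ n₀ * (w 0 ^ 2 + w 1 ^ 2) := by gcongr
    _ ≤ n 0 * w 0 ^ 2 + n 1 * w 1 ^ 2 := by
        rw [mul_add]
        gcongr

variable {N : ℕ}

lemma dotProduct_mulVec_orthogonal {O : Matrix (Fin N) (Fin N) ℝ}
    (hO : O ∈ Matrix.orthogonalGroup (Fin N) ℝ) (x y : Fin N → ℝ) :
    (O *ᵥ x) ⬝ᵥ (O *ᵥ y) = x ⬝ᵥ y := by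
  rw [Matrix.dotProduct_mulVec, Matrix.vecMul_mulVec, ← Matrix.dotProduct_mulVec]
  have : Oᵀ * O = 1 := (Matrix.mem_orthogonalGroup_iff' _ _).1 hO
  rw [this, Matrix.one_mulVec]

/-- The part of the Courant-Fischer principle that is needed for the second singular value. -/
lemma IsSVD.mulVec_le {A L R : Matrix (Fin N) (Fin N) ℝ} {σ : Fin N → ℝ} (h : IsSVD A L σ R)
    (hN : 2 ≤ N) (x : Fin N → ℝ) (hx : ∑ i, R i (Fin.castLE hN 0) * x i = 0) :
    (A *ᵥ x) ⬝ᵥ (A *ᵥ x) ≤ σ (Fin.castLE hN 1) ^ 2 * (x ⬝ᵥ x) := by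
  have hRT : Rᵀ ∈ Matrix.orthogonalGroup (Fin N) ℝ := by
    rw [Matrix.mem_orthogonalGroup_iff]
    exact (Matrix.mem_orthogonalGroup_iff' _ _).1 h.right_orthogonal
  rw [h.eq, ← Matrix.mulVec_mulVec, ← Matrix.mulVec_mulVec,
    dotProduct_mulVec_orthogonal h.left_orthogonal, ← dotProduct_mulVec_orthogonal hRT x x]
  have hz : (Rᵀ *ᵥ x) (Fin.castLE hN 0) = 0 := by
    simpa [Matrix.mulVec, dotProduct] using hx
  simp only [Matrix.mulVec_diagonal, dotProduct, Finset.mul_sum]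
  refine Finset.sum_le_sum fun i _ => ?_
  by_cases hi : i = Fin.castLE hN 0
  · rw [hi, hz]; simp
  · have h1 : Fin.castLE hN 1 ≤ i := by
      rw [Fin.le_def]
      rw [Fin.ext_iff] at hi
      simp at hi ⊢
      omega
    have h2 := pow_le_pow_left₀ (h.nonneg i) (h.antitone h1) 2
    nlinarith [mul_self_nonneg ((Rᵀ *ᵥ x) i)]

/-- The block-constant vectors form a plane, so some nonzero one is orthogonal to the first right
singular vector. On it `A` stretches by at most the second singular value, while `blockMatrix_lower`
bounds the stretch of the block matrix from below. -/
lemma IsSVD.second_singular_value_lower {A L R : Matrix (Fin N) (Fin N) ℝ} {σ : Fin N → ℝ}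
    (h : IsSVD A L σ R) (hN : 2 ≤ N) {B : Matrix (Fin 2) (Fin 2) ℝ}
    (hB : ∀ k l, 0 ≤ B k l ∧ B k l ≤ 1) (t : Fin N → Fin 2) {n₀ : ℝ} (hn₀ : 0 < n₀)
    (hn : ∀ k, n₀ ≤ (block t k).card) {D : ℝ} (hE : SqOpNormLE (A - blockMatrix B t) D) :
    n₀ ^ 2 * (B.det ^ 2 / 4) ≤ 2 * σ (Fin.castLE hN 1) ^ 2 + 2 * D := by
  set ρ : Fin 2 → ℝ := fun k => ∑ i, R i (Fin.castLE hN 0) * (if t i = k then 1 else 0) with hρ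
  obtain ⟨a, ha, hρa⟩ : ∃ a : Fin 2 → ℝ, a ≠ 0 ∧ ρ 0 * a 0 + ρ 1 * a 1 = 0 := by
    by_cases h0 : ρ 0 = 0
    · exact ⟨![1, 0], fun hc => by simpa using congrFun hc 0, by simp [h0]⟩
    · exact ⟨![-ρ 1, ρ 0], fun hc => h0 (by simpa using congrFun hc 1), by simp; ring⟩
  set x : Fin N → ℝ := a ∘ t with hx
  have hxa : ∀ i, x i = a 0 * (if t i = 0 then 1 else 0) + a 1 * (if t i = 1 then 1 else 0) := by
    intro i
    simp only [hx, Function.comp]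
    rcases Fin.exists_fin_two.1 ⟨t i, rfl⟩ with h | h <;> simp [h]
  have horth : ∑ i, R i (Fin.castLE hN 0) * x i = 0 := by
    rw [← hρa]
    simp only [hρ, Finset.sum_mul, ← Finset.sum_add_distrib]
    exact Finset.sum_congr rfl fun i _ => by rw [hxa]; ring
  have hxpos : 0 < x ⬝ᵥ x := by
    simp only [dotProduct, hx, Function.comp]
    rw [sum_comp_label t fun l => a l * a l]
    have h0 := hn 0
    have h1 := hn 1
    have : a 0 ≠ 0 ∨ a 1 ≠ 0 := by
      by_contra! hc
      exact ha (funext fun k => by fin_cases k <;> simp [hc.1, hc.2])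
    rcases this with hk | hk
    · have := mul_pos (hn₀.trans_le h0) (mul_self_pos.2 hk)
      have := mul_nonneg (hn₀.le.trans h1) (mul_self_nonneg (a 1))
      linarith
    · have := mul_pos (hn₀.trans_le h1) (mul_self_pos.2 hk)
      have := mul_nonneg (hn₀.le.trans h0) (mul_self_nonneg (a 0))
      linarith
  have hlow := blockMatrix_lower hB t hn₀.le hn a
  rw [← hx] at hlow
  have hPx : blockMatrix B t *ᵥ x = A *ᵥ x + -((A - blockMatrix B t) *ᵥ x) := by
    rw [Matrix.sub_mulVec]; abel
  have h1 := dotProduct_self_add_le (A *ᵥ x) (-((A - blockMatrix B t) *ᵥ x))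
  rw [← hPx, neg_dotProduct_neg] at h1
  have h2 := h.mulVec_le hN x horth
  have h3 := hE x
  refine le_of_mul_le_mul_right ?_ hxpos
  linarith

lemma IsSVD.mulVec_col {A L R : Matrix (Fin N) (Fin N) ℝ} {σ : Fin N → ℝ} (h : IsSVD A L σ R)
    (k : Fin N) : A *ᵥ R.col k = σ k • L.col k := by
  have hR : Rᵀ * R = 1 := (Matrix.mem_orthogonalGroup_iff' _ _).1 h.right_orthogonal
  have hAR : A * R = L * Matrix.diagonal σ := by
    rw [h.eq, Matrix.mul_assoc, hR, Matrix.mul_one]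
  ext i
  have := congrFun (congrFun hAR i) k
  rw [Matrix.mul_diagonal] at this
  simpa [Matrix.mulVec, dotProduct, Matrix.mul_apply, mul_comm] using this

lemma IsSVD.transpose {A L R : Matrix (Fin N) (Fin N) ℝ} {σ : Fin N → ℝ} (h : IsSVD A L σ R) :
    IsSVD Aᵀ R σ L where
  left_orthogonal := h.right_orthogonal
  right_orthogonal := h.left_orthogonal
  antitone := h.antitone
  nonneg := h.nonneg
  eq := by
    conv_lhs => rw [h.eq]
    simp [Matrix.transpose_mul, Matrix.mul_assoc]

lemma col_dotProduct_col {O : Matrix (Fin N) (Fin N) ℝ}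
    (hO : O ∈ Matrix.orthogonalGroup (Fin N) ℝ) (k l : Fin N) :
    O.col k ⬝ᵥ O.col l = if k = l then 1 else 0 := by
  have : Oᵀ * O = 1 := (Matrix.mem_orthogonalGroup_iff' _ _).1 hO
  have := congrFun (congrFun this k) l
  simpa [Matrix.mul_apply, Matrix.one_apply, dotProduct] using this

/-- A left singular vector is close to a vector which is constant on blocks. -/
lemma IsSVD.left_col_near_block {A L R : Matrix (Fin N) (Fin N) ℝ} {σ : Fin N → ℝ}
    (h : IsSVD A L σ R) {B : Matrix (Fin 2) (Fin 2) ℝ} (t : Fin N → Fin 2) {D : ℝ}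
    (hE : SqOpNormLE (A - blockMatrix B t) D) (k : Fin N) {m : ℝ} (hm : 0 < m)
    (hσ : m ≤ σ k ^ 2) (hD : 0 ≤ D) :
    ∃ f : Fin 2 → ℝ, ∑ u, (L u k - f (t u)) ^ 2 ≤ D / m := by
  have hσ0 : σ k ≠ 0 := by
    intro h0
    rw [h0] at hσ
    norm_num at hσ
    linarith
  -- From `A *ᵥ R.col k = σ k • L.col k`: replacing `A` by the block matrix gives this
  -- block-constant vector, and the error is the noise applied to a unit vector, divided by `σ k`.
  refine ⟨fun l => (∑ j, B l (t j) * R j k) / σ k, ?_⟩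
  have hcol := h.mulVec_col k
  have hval : ∀ u, L u k - (∑ j, B (t u) (t j) * R j k) / σ k =
      ((A - blockMatrix B t) *ᵥ R.col k) u / σ k := by
    intro u
    have := congrFun hcol u
    rw [Matrix.sub_mulVec, hcol]
    simp only [blockMatrix, Matrix.mulVec, dotProduct, Pi.sub_apply, Pi.smul_apply, smul_eq_mul,
      Matrix.of_apply, Matrix.col_apply]
    field_simp
  have hE' := hE (R.col k)
  rw [col_dotProduct_col h.right_orthogonal, if_pos rfl, mul_one] at hE'
  calc ∑ u, (L u k - (∑ j, B (t u) (t j) * R j k) / σ k) ^ 2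
      = ((A - blockMatrix B t) *ᵥ R.col k) ⬝ᵥ ((A - blockMatrix B t) *ᵥ R.col k) / σ k ^ 2 := by
        rw [dotProduct, Finset.sum_div]
        exact Finset.sum_congr rfl fun u _ => by rw [hval, div_pow, sq (Matrix.mulVec _ _ u)]
    _ ≤ D / m := div_le_div₀ hD hE' hm hσ

/-- If two orthonormal vectors are close to vectors which are constant on blocks, then the values
of the latter on the two blocks are well separated. -/
lemma separation_of_orthonormal (U : Matrix (Fin N) (Fin 2) ℝ) (hU : Uᵀ * U = 1)
    (t : Fin N → Fin 2) (f : Fin 2 → Fin 2 → ℝ) {e : ℝ}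
    (hf : ∀ k, ∑ u, (U u k - f k (t u)) ^ 2 ≤ e) (he : e ≤ 1 / 8) :
    1 / 4 ≤ N * ∑ k, (f k 0 - f k 1) ^ 2 := by
  -- The combination with coefficients `y` vanishes on block `0`, so on block `1` it is controlled
  -- by the gap. The same combination of the columns of `U` has squared norm `Y`, which forces the
  -- gap to be large.
  obtain ⟨y, hy, hfy⟩ : ∃ y : Fin 2 → ℝ, 0 < y 0 ^ 2 + y 1 ^ 2 ∧ f 0 0 * y 0 + f 1 0 * y 1 = 0 := by
    by_cases h0 : f 0 0 = 0
    · exact ⟨![1, 0], by norm_num, by simp [h0]⟩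
    · exact ⟨![-f 1 0, f 0 0], add_pos_of_nonneg_of_pos (sq_nonneg _) (sq_pos_of_ne_zero h0), by simp; ring⟩
  set Y := y 0 ^ 2 + y 1 ^ 2 with hY
  have h00 : ∑ u, U u 0 * U u 0 = 1 := by
    simpa [Matrix.mul_apply] using congrFun (congrFun hU 0) 0
  have h01 : ∑ u, U u 0 * U u 1 = 0 := by
    simpa [Matrix.mul_apply] using congrFun (congrFun hU 0) 1
  have h11 : ∑ u, U u 1 * U u 1 = 1 := by
    simpa [Matrix.mul_apply] using congrFun (congrFun hU 1) 1
  have hUy : ∑ u, (U u 0 * y 0 + U u 1 * y 1) ^ 2 = Y := by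
    calc _ = (∑ u, U u 0 * U u 0) * y 0 ^ 2 + 2 * (∑ u, U u 0 * U u 1) * (y 0 * y 1) +
          (∑ u, U u 1 * U u 1) * y 1 ^ 2 := by
          rw [Finset.mul_sum, Finset.sum_mul, Finset.sum_mul, Finset.sum_mul,
            ← Finset.sum_add_distrib, ← Finset.sum_add_distrib]
          exact Finset.sum_congr rfl fun u _ => by ring
      _ = Y := by rw [h00, h01, h11]; ring
  set G := (f 0 0 - f 0 1) ^ 2 + (f 1 0 - f 1 1) ^ 2 with hG
  have hpt : ∀ u, (U u 0 * y 0 + U u 1 * y 1) ^ 2 ≤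
      2 * (G * Y) + 2 * (((U u 0 - f 0 (t u)) ^ 2 + (U u 1 - f 1 (t u)) ^ 2) * Y) := by
    intro u
    have hC : (f 0 (t u) * y 0 + f 1 (t u) * y 1) ^ 2 ≤ G * Y := by
      rcases Fin.exists_fin_two.1 ⟨t u, rfl⟩ with h | h
      · rw [h, hfy, zero_pow two_ne_zero]; positivity
      · have : f 0 1 * y 0 + f 1 1 * y 1 = -((f 0 0 - f 0 1) * y 0 + (f 1 0 - f 1 1) * y 1) := by
          linear_combination hfy
        rw [h, this, hG, hY]
        nlinarith [sq_nonneg ((f 0 0 - f 0 1) * y 1 - (f 1 0 - f 1 1) * y 0)]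
    have hD : ((U u 0 - f 0 (t u)) * y 0 + (U u 1 - f 1 (t u)) * y 1) ^ 2 ≤
        ((U u 0 - f 0 (t u)) ^ 2 + (U u 1 - f 1 (t u)) ^ 2) * Y := by
      rw [hY]
      nlinarith [sq_nonneg ((U u 0 - f 0 (t u)) * y 1 - (U u 1 - f 1 (t u)) * y 0)]
    have e1 : U u 0 * y 0 + U u 1 * y 1 = (f 0 (t u) * y 0 + f 1 (t u) * y 1) +
        ((U u 0 - f 0 (t u)) * y 0 + (U u 1 - f 1 (t u)) * y 1) := by ring
    have := add_sq_le (a := f 0 (t u) * y 0 + f 1 (t u) * y 1)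
      (b := (U u 0 - f 0 (t u)) * y 0 + (U u 1 - f 1 (t u)) * y 1)
    rw [e1]
    linarith
  have hsum := Finset.sum_le_sum fun u (_ : u ∈ Finset.univ) => hpt u
  have hsplit : ∑ u, 2 * (((U u 0 - f 0 (t u)) ^ 2 + (U u 1 - f 1 (t u)) ^ 2) * Y) =
      2 * ((∑ u, (U u 0 - f 0 (t u)) ^ 2 + ∑ u, (U u 1 - f 1 (t u)) ^ 2) * Y) := by
    rw [← Finset.sum_add_distrib, Finset.sum_mul, Finset.mul_sum]
  rw [hUy, Finset.sum_add_distrib, hsplit, Finset.sum_const, Finset.card_univ, Fintype.card_fin,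
    nsmul_eq_mul] at hsum
  have hf' := mul_le_mul_of_nonneg_right (add_le_add (hf 0) (hf 1)) hy.le
  have he' := mul_le_mul_of_nonneg_right he hy.le
  rw [Fin.sum_univ_two, ← hG]
  refine le_of_mul_le_mul_right ?_ hy
  linarith

end Deterministic

/-! ### Counting the errors of a `K`-means minimizer. -/

section KMeans

variable {N : ℕ}

/-- Each block is larger than `S`, so both true labels occur outside `S`. There the estimated label
determines the true one, and the resulting bijection of labels is the required permutation. -/
lemma misclustered_le_of_injOn (t t' : Fin N → Fin 2) (S : Finset (Fin N))
    (hS : ∀ u ∉ S, ∀ v ∉ S, t' u = t' v → t u = t v) (hblock : ∀ k, S.card < (block t k).card) :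
    misclustered t t' ≤ S.card := by
  have hex : ∀ k, ∃ u, u ∉ S ∧ t u = k := by
    intro k
    by_contra! hc
    refine absurd (Finset.card_le_card fun u hu => ?_) (not_le.2 (hblock k))
    by_contra huS
    exact hc u huS (Finset.mem_filter.1 hu).2
  choose w hwS hw using hex
  have hne : t' (w 0) ≠ t' (w 1) := fun h => by
    have := hS _ (hwS 0) _ (hwS 1) h
    rw [hw, hw] at this
    exact absurd this (by decide)
  have hinj : Function.Injective fun k => t' (w k) := by
    intro k l hkl
    fin_cases k <;> fin_cases l <;> simp_all
  let ρ : Equiv.Perm (Fin 2) :=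
    (Equiv.ofBijective _ ⟨hinj, Finite.injective_iff_surjective.1 hinj⟩).symm
  have hρ : ∀ k, ρ (t' (w k)) = k := fun k =>
    Equiv.ofBijective_symm_apply_apply _ _ k
  refine (Finset.inf'_le _ (Finset.mem_univ ρ)).trans (Finset.card_le_card fun u hu => ?_)
  by_contra huS
  refine (Finset.mem_filter.1 hu).2 ?_
  obtain ⟨k, hk⟩ : ∃ k, t' (w k) = t' u := Finite.injective_iff_surjective.1 hinj (t' u)
  rw [← hk, hρ, ← hw k]
  exact hS _ huS _ (hwS k) hk.symm

/-- If the rows of `W` are close to vectors which depend only on the block, and these are well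
separated, then a minimiser of the `K`-means objective misclassifies few nodes. -/
lemma IsKMeansSolution.misclustered_le {ι : Type*} [Fintype ι] {W : Matrix (Fin N) ι ℝ}
    {c : Fin 2 → ι → ℝ} {t' : Fin N → Fin 2} (h : IsKMeansSolution W c t') (t : Fin N → Fin 2)
    (x : Fin 2 → ι → ℝ) {e g : ℝ} (hx : kMeansCost W x t ≤ e) (hg : 0 < g)
    (hsep : g ≤ ∑ j, (x 0 j - x 1 j) ^ 2) (hblock : ∀ k, 16 * e / g < (block t k).card) :
    (misclustered t t' : ℝ) ≤ 16 * e / g := by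
  classical
  set d : Fin N → ℝ := fun u => ∑ j, (c (t' u) j - x (t u) j) ^ 2 with hd
  have hd0 : ∀ u, 0 ≤ d u := fun u => Finset.sum_nonneg fun j _ => sq_nonneg _
  have hdsum : ∑ u, d u ≤ 4 * e := by
    have h1 : ∑ u, d u ≤ 2 * kMeansCost W c t' + 2 * kMeansCost W x t := by
      simp only [kMeansCost, hd, Finset.mul_sum, ← Finset.sum_add_distrib]
      refine Finset.sum_le_sum fun u _ => Finset.sum_le_sum fun j _ => ?_
      nlinarith [sq_nonneg (2 * W u j - c (t' u) j - x (t u) j)]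
    have := h x t
    linarith
  -- With threshold `g / 4`, two nodes outside `S` sharing an estimated center have block centers at
  -- squared distance below `g`, hence lie in the same block.
  set S := Finset.univ.filter fun u => g / 4 ≤ d u with hSdef
  have hScard : (S.card : ℝ) ≤ 16 * e / g := by
    have h1 : (S.card : ℝ) * (g / 4) ≤ ∑ u, d u := by
      rw [← nsmul_eq_mul]
      refine (Finset.card_nsmul_le_sum S d _ fun u hu => (Finset.mem_filter.1 hu).2).trans ?_
      exact Finset.sum_le_sum_of_subset_of_nonneg (Finset.filter_subset _ _) fun u _ _ => hd0 u
    rw [le_div_iff₀ hg]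
    linarith
  refine le_trans ?_ hScard
  refine Nat.cast_le.2 (misclustered_le_of_injOn t t' S ?_ fun k => ?_)
  · intro u hu v hv huv
    have hu' : d u < g / 4 := by simpa [hSdef] using hu
    have hv' : d v < g / 4 := by simpa [hSdef] using hv
    by_contra hne
    have h1 : ∑ j, (x (t u) j - x (t v) j) ^ 2 ≤ 2 * d u + 2 * d v := by
      simp only [hd, Finset.mul_sum, ← Finset.sum_add_distrib]
      refine Finset.sum_le_sum fun j _ => ?_
      rw [huv]
      nlinarith [sq_nonneg (2 * c (t' v) j - x (t u) j - x (t v) j)]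
    have h2 : ∑ j, (x (t u) j - x (t v) j) ^ 2 = ∑ j, (x 0 j - x 1 j) ^ 2 := by
      rcases Fin.exists_fin_two.1 ⟨t u, rfl⟩ with h | h <;>
        rcases Fin.exists_fin_two.1 ⟨t v, rfl⟩ with h' | h'
      · exact absurd (h.trans h'.symm) hne
      · rw [h, h']
      · rw [h, h']
        exact Finset.sum_congr rfl fun j _ => by ring
      · exact absurd (h.trans h'.symm) hne
    linarith
  · exact_mod_cast hScard.trans_lt (hblock k)

end KMeans

/-! ### Assembling the constant bound and comparing it with `log N`. -/

section Main

/-- The number of misclustered nodes is bounded once the noise has operator norm `O(√N)`. -/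
lemma misclustered_le_of_opNorm {N : ℕ} {B : Matrix (Fin 2) (Fin 2) ℝ}
    (hB : ∀ k l, 0 ≤ B k l ∧ B k l ≤ 1) (hdet : B.det ≠ 0) (t : Fin N → Fin 2) {κ θ : ℝ}
    (hκ : 0 < κ) (hθ : θ = κ ^ 2 * B.det ^ 2 / 16) (hn : ∀ k, κ * N ≤ (block t k).card)
    (hN : 1 ≤ N) (hNθ : 8 * 802 ≤ θ * N) (hNκ : 256 * 802 / θ < κ * N)
    (A : Matrix (Fin N) (Fin N) ℝ)
    (hE : SqOpNormLE (A - meanMatrix B t) (400 * N) ∧ SqOpNormLE (A - meanMatrix B t)ᵀ (400 * N))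
    {U V : Matrix (Fin N) (Fin 2) ℝ} (hUV : IsTopSingularVectors A U V)
    {c : Fin 2 → Fin 2 ⊕ Fin 2 → ℝ} {t' : Fin N → Fin 2}
    (hsol : IsKMeansSolution (Matrix.fromCols U V) c t') :
    (misclustered t t' : ℝ) ≤ 256 * 802 / θ := by
  obtain ⟨h2N, L, σ, R, hsvd, rfl, rfl⟩ := hUV
  have hN' : (1 : ℝ) ≤ N := by exact_mod_cast hN
  have hN0 : (0 : ℝ) < N := by linarith
  have hθ0 : 0 < θ := by rw [hθ]; positivity
  obtain ⟨hE1, hE2⟩ := sqOpNormLE_sub_blockMatrix hB t A hE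
  set D : ℝ := 2 * (400 * N) + 2 * 1 with hDdef
  have hD : D ≤ 802 * N := by rw [hDdef]; linarith
  have hD0 : 0 ≤ D := by positivity
  have hθN : 8 * D ≤ θ * N ^ 2 := by nlinarith
  -- The `16` in `θ` makes the signal term `4 θ N²`, leaving room for the noise `2 D` and the factor
  -- `2`.
  have hσ1 : θ * N ^ 2 ≤ σ (Fin.castLE h2N 1) ^ 2 := by
    have := hsvd.second_singular_value_lower h2N hB t (by positivity : 0 < κ * N) hn hE1
    have h4 : (κ * N) ^ 2 * (B.det ^ 2 / 4) = 4 * (θ * N ^ 2) := by rw [hθ]; ring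
    linarith
  have hσ : ∀ k : Fin 2, θ * N ^ 2 ≤ σ (Fin.castLE h2N k) ^ 2 := fun k =>
    hσ1.trans (pow_le_pow_left₀ (hsvd.nonneg _) (hsvd.antitone (by
      rw [Fin.le_def]
      fin_cases k <;> simp)) 2)
  have hm : 0 < θ * (N : ℝ) ^ 2 := by positivity
  choose f hf using fun k => hsvd.left_col_near_block t hE1 (Fin.castLE h2N k) hm (hσ k) hD0
  have hE2' : SqOpNormLE (Aᵀ - blockMatrix Bᵀ t) D := by
    have : Aᵀ - blockMatrix Bᵀ t = (A - blockMatrix B t)ᵀ := by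
      rw [Matrix.transpose_sub]; rfl
    rw [this]
    exact hE2
  choose f' hf' using fun k =>
    hsvd.transpose.left_col_near_block t hE2' (Fin.castLE h2N k) hm (hσ k) hD0
  set e := D / (θ * (N : ℝ) ^ 2) with he
  have he8 : e ≤ 1 / 8 := by rw [he, div_le_iff₀ hm]; linarith
  have heN : e * N ≤ 802 / θ := by
    have : e * N = D / N / θ := by rw [he]; field_simp
    rw [this]
    gcongr
    rwa [div_le_iff₀ hN0]
  have hU : (L.submatrix id (Fin.castLE h2N))ᵀ * L.submatrix id (Fin.castLE h2N) = 1 := by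
    ext k l
    have := col_dotProduct_col hsvd.left_orthogonal (Fin.castLE h2N k) (Fin.castLE h2N l)
    simp only [(Fin.castLE_injective h2N).eq_iff] at this
    simpa [Matrix.mul_apply, Matrix.one_apply, dotProduct] using this
  have hsep := separation_of_orthonormal _ hU t f (e := e) hf he8
  set x : Fin 2 → Fin 2 ⊕ Fin 2 → ℝ := fun i => Sum.elim (fun k => f k i) fun k => f' k i with hx
  have hcost : kMeansCost (Matrix.fromCols (L.submatrix id (Fin.castLE h2N))
      (R.submatrix id (Fin.castLE h2N))) x t ≤ 4 * e := by
    have h0 := hf 0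
    have h1 := hf 1
    have h0' := hf' 0
    have h1' := hf' 1
    simp only [kMeansCost, Fintype.sum_sum_type, Fin.sum_univ_two, Finset.sum_add_distrib, hx,
      Matrix.fromCols_apply_inl, Matrix.fromCols_apply_inr, Sum.elim_inl, Sum.elim_inr,
      Matrix.submatrix_apply, id]
    linarith
  -- Four columns each contribute error `e`. The squared gap `1 / (4 N)` comes from the left
  -- singular vectors alone; the right ones can only increase it.
  have hbound : 16 * (4 * e) / (1 / (4 * N)) ≤ 256 * 802 / θ := by
    have : 16 * (4 * e) / (1 / (4 * (N : ℝ))) = 256 * (e * N) := by field_simp; ring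
    rw [this, mul_div_assoc]
    gcongr
  refine (hsol.misclustered_le t x hcost (by positivity : 0 < 1 / (4 * (N : ℝ))) ?_
    fun k => hbound.trans_lt (hNκ.trans_le (hn k))).trans hbound
  rw [Fintype.sum_sum_type]
  have h1 : 1 / (4 * (N : ℝ)) ≤ ∑ k, (f k 0 - f k 1) ^ 2 := by
    rw [div_le_iff₀ (by positivity)]
    linarith
  have h2 : 0 ≤ ∑ k, (f' k 0 - f' k 1) ^ 2 := Finset.sum_nonneg fun _ _ => sq_nonneg _
  simp only [hx, Sum.elim_inl, Sum.elim_inr]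
  linarith

lemma IsSVD.last_pos {B L R : Matrix (Fin 2) (Fin 2) ℝ} {Λ : Fin 2 → ℝ} (h : IsSVD B L Λ R)
    (hdet : B.det ≠ 0) : 0 < Λ 1 := by
  refine lt_of_le_of_ne (h.nonneg 1) fun h0 => hdet ?_
  rw [h.eq, Matrix.det_mul, Matrix.det_mul, Matrix.det_diagonal, Fin.prod_univ_two, ← h0]
  ring

/-- This removes the random quantities from the bound, so that a single deterministic multiple of
`log N` handles both forms of the conclusion. -/
lemma aseBound_lower {T T₀ β b m : ℝ} (hT₀ : 0 ≤ T₀) (hT : T₀ ≤ T) (hβ : 0 < β) (hb : 0 < b)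
    (hm : 0 < m) (hm1 : m ≤ 1) {N : ℕ} (hN : 1 ≤ N) : aseBound T₀ β b 1 N ≤ aseBound T β b m N := by
  have hlog : 0 ≤ Real.log N := Real.log_nonneg (by exact_mod_cast hN)
  have hT' : 0 ≤ T := hT₀.trans hT
  unfold aseBound
  gcongr

/-- As `s ≤ r`, each of the `N` nodes contributes at least `1 - r ^ 2` to the first block sum,
whatever the labels. -/
lemma sq_le_sampleT {N : ℕ} (hN : 1 ≤ N) (t : Fin N → Fin 2) {q r s : ℝ} (hs : 0 ≤ s)
    (hsr : s ≤ r) (hr : r ≤ 1) : (1 - r ^ 2) ^ 2 ≤ sampleT t q r s := by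
  have hN' : (0 : ℝ) < N := by exact_mod_cast hN
  have hcard : ((block t 0).card : ℝ) + (block t 1).card = N := by
    have := sum_comp_label t fun _ => (1 : ℝ)
    simp at this
    linarith
  have hr2 : 0 ≤ 1 - r ^ 2 := by nlinarith
  have hrs : 1 - r ^ 2 ≤ 1 - s ^ 2 := by nlinarith
  have h1 : (1 - r ^ 2) * N ≤ blockSum t r s := by
    simp only [blockSum, Finset.sum_const, nsmul_eq_mul]
    rw [← hcard]
    nlinarith [mul_le_mul_of_nonneg_left hrs (Nat.cast_nonneg (α := ℝ) (block t 1).card)]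
  have h2 := pow_le_pow_left₀ (mul_nonneg hr2 hN'.le) h1 2
  rw [sampleT, le_div_iff₀ (by positivity)]
  nlinarith [sq_nonneg (blockSum t q s)]

lemma sq_le_limitT {π : Fin 2 → ℝ} (hπ : ∀ k, 0 < π k) (hsum : ∑ k, π k = 1) {q r s : ℝ}
    (hs : 0 ≤ s) (hsr : s ≤ r) (hr : r ≤ 1) : (1 - r ^ 2) ^ 2 ≤ limitT π q r s := by
  rw [Fin.sum_univ_two] at hsum
  have hr2 : 0 ≤ 1 - r ^ 2 := by nlinarith
  have hrs : 1 - r ^ 2 ≤ 1 - s ^ 2 := by nlinarith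
  have h1 : 1 - r ^ 2 ≤ π 0 * (1 - r ^ 2) + π 1 * (1 - s ^ 2) := by
    have := mul_le_mul_of_nonneg_left hrs (hπ 1).le
    have e : 1 - r ^ 2 = (π 0 + π 1) * (1 - r ^ 2) := by rw [hsum, one_mul]
    linarith
  have h2 := pow_le_pow_left₀ hr2 h1 2
  rw [limitT]
  nlinarith [sq_nonneg (π 0 * (1 - q ^ 2) + π 1 * (1 - s ^ 2))]

end Main


theorem corollary2
    {Ω : Type*} [MeasurableSpace Ω] (P : Measure Ω) [IsProbabilityMeasure P]
    -- the core-periphery block probability matrix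
    (p q r s : ℝ) (hs : 0 ≤ s) (hsr : s < r) (hsq : s < q) (hrp : r < p) (hqp : q < p)
    (hp : p ≤ 1)
    (B : Matrix (Fin 2) (Fin 2) ℝ) (hB : B = !![p, q; r, s]) (hrank : B.rank = 2)
    -- the block proportions
    (π : Fin 2 → ℝ) (hπ : ∀ k, π k ∈ Set.Ioo (0 : ℝ) 1) (hπsum : ∑ k, π k = 1)
    -- the directed stochastic block model
    (τ : (N : ℕ) → Ω → Fin N → Fin 2) (A : (N : ℕ) → Ω → Fin N → Fin N → Bool)
    (hSBM : IsDirectedSBM P B τ A)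
    (hτ : LabelsIID P π τ ∨ LabelsHaveProportions P π τ)
    -- `b` is the smallest singular value of `B`
    (L R : Matrix (Fin 2) (Fin 2) ℝ) (Λ : Fin 2 → ℝ) (hsvd : IsSVD B L Λ R)
    (b : ℝ) (hb : b = Λ 1)
    -- `β` is the separation of the latent positions
    (ν μ : Matrix (Fin 2) (Fin 2) ℝ) (hνμ : B = ν * μᵀ)
    (β : ℝ) (hβ : 0 < β)
    (hsep : ∀ u v : Fin 2, u ≠ v →
      β < ‖WithLp.toLp 2 (ν u - ν v)‖ ∨ β < ‖WithLp.toLp 2 (μ u - μ v)‖) :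
    ∀ᵐ ω ∂P, ∀ᶠ N : ℕ in atTop,
      0 < sampleT (τ N ω) q r s ∧ 0 < limitT π q r s ∧
      ∀ U V : Matrix (Fin N) (Fin 2) ℝ,
        IsTopSingularVectors (adjacencyMatrix (A N ω)) U V →
        ∀ (c : Fin 2 → Fin 2 ⊕ Fin 2 → ℝ) (τhat : Fin N → Fin 2),
          IsKMeansSolution (Matrix.fromCols U V) c τhat →
          (misclustered (τ N ω) τhat : ℝ) ≤
            aseBound (sampleT (τ N ω) q r s) β b
              (min (proportion (τ N ω) 0) (proportion (τ N ω) 1)) N ∧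
          (misclustered (τ N ω) τhat : ℝ) ≤
            aseBound (limitT π q r s) β b (min (π 0) (π 1)) N := by
  have hB01 : ∀ k l, 0 ≤ B k l ∧ B k l ≤ 1 := by
    intro k l
    rw [hB]
    fin_cases k <;> fin_cases l <;> constructor <;> simp <;> linarith
  have hdet : B.det ≠ 0 := by
    refine IsUnit.ne_zero ((Matrix.isUnit_iff_isUnit_det B).1
      (Matrix.linearIndependent_rows_iff_isUnit.1 ?_))
    rw [linearIndependent_iff_card_eq_finrank_span, Fintype.card_fin]
    exact hrank.symm.trans (Matrix.rank_eq_finrank_span_row B)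
  have hb0 : 0 < b := hb ▸ hsvd.last_pos hdet
  have hπ0 : ∀ k, 0 < π k := fun k => (hπ k).1
  have hr1 : r < 1 := hrp.trans_le hp
  have hr2 : 0 < 1 - r ^ 2 := by nlinarith
  set κ := min (π 0) (π 1) / 2 with hκdef
  have hκ : 0 < κ := half_pos (lt_min (hπ0 0) (hπ0 1))
  set θ := κ ^ 2 * B.det ^ 2 / 16 with hθdef
  have hθ : 0 < θ := by positivity
  have hbound : ∀ᶠ N : ℕ in atTop, 256 * 802 / θ ≤ aseBound ((1 - r ^ 2) ^ 2) β b 1 N :=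
    ((Real.tendsto_log_atTop.comp tendsto_natCast_atTop_atTop).const_mul_atTop
      (by positivity)).eventually_ge_atTop _
  filter_upwards [hSBM.ae_eventually_opNorm hB01, ae_eventually_block_card hπ0 hπsum hτ 0,
    ae_eventually_block_card hπ0 hπsum hτ 1] with ω hω h0 h1
  filter_upwards [hω, h0, h1, hbound, eventually_ge_atTop 1,
    (tendsto_natCast_atTop_atTop.const_mul_atTop hθ).eventually_ge_atTop (8 * 802),
    (tendsto_natCast_atTop_atTop.const_mul_atTop hκ).eventually_gt_atTop (256 * 802 / θ)]
    with N hE h0 h1 hbound hN hNθ hNκ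
  have hsT : (1 - r ^ 2) ^ 2 ≤ sampleT (τ N ω) q r s := sq_le_sampleT hN _ hs hsr.le hr1.le
  have hlT : (1 - r ^ 2) ^ 2 ≤ limitT π q r s := sq_le_limitT hπ0 hπsum hs hsr.le hr1.le
  refine ⟨lt_of_lt_of_le (by positivity) hsT, lt_of_lt_of_le (by positivity) hlT,
    fun U V hUV c τhat hsol => ?_⟩
  have hN0 : (0 : ℝ) < N := by exact_mod_cast hN
  have hn : ∀ k, κ * N ≤ (block (τ N ω) k).card := by
    intro k
    have hmin : κ ≤ π k / 2 := by
      rw [hκdef]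
      gcongr
      fin_cases k
      · exact min_le_left _ _
      · exact min_le_right _ _
    refine (mul_le_mul_of_nonneg_right hmin hN0.le).trans ?_
    fin_cases k
    · exact h0
    · exact h1
  have hmis := (misclustered_le_of_opNorm hB01 hdet (τ N ω) hκ hθdef hn hN hNθ hNκ _ hE hUV
    hsol).trans hbound
  have hprop : ∀ k, 0 < proportion (τ N ω) k := fun k =>
    div_pos ((mul_pos hκ hN0).trans_le (hn k)) hN0
  have hprop1 : proportion (τ N ω) 0 ≤ 1 := by
    rw [proportion, div_le_one hN0]
    exact_mod_cast (Finset.card_le_univ _).trans_eq (Fintype.card_fin N)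
  exact ⟨hmis.trans (aseBound_lower (sq_nonneg _) hsT hβ hb0 (lt_min (hprop 0) (hprop 1))
      ((min_le_left _ _).trans hprop1) hN),
    hmis.trans (aseBound_lower (sq_nonneg _) hlT hβ hb0 (lt_min (hπ0 0) (hπ0 1))
      ((min_le_left _ _).trans (hπ 0).2.le) hN)⟩
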